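/- Conventions. For a poset $S$, an initial segment of $S$ is a downward closed subset (possibly empty), and $I_{<\omega}(S)$ denotes the set of finitely generated initial segments of $S$ (those of the form $\downarrow F$ with $F\subseteq S$ finite, $F=\emptyset$ allowed), ordered by inclusion; it is a join-semilattice whose join is union. For a join-semilattice $P$, $J(P)$ denotes the poset of ideals of $P$ (non-empty up-directed initial segments), ordered by inclusion. For an order type $\alpha$, $I(\alpha)$ is the order type of the chain of all initial segments of a chain of type $\alpha$, and $\mathbb J_\alpha$ is the class of join-semilattices $P$ having a least element such that $J(P)$ contains a chain of order type $I(\alpha)$. $[\omega]^{<\omega}$ is the join-semilattice of finite subsets of $\omega$, ordered by inclusion; a join-subsemilattice is a subset closed under binary joins. A join-semilattice $Q$ embeds as a join-semilattice in $P$ if there is a one-to-one map $f:Q\to P$ with $f(x\vee y)=f(x)\vee f(y)$ for all $x,y\in Q$. For an ordinal $\alpha'$, $\omega\alpha'$ is the ordinal sum of $\alpha'$ copies $\omega\times\{\beta\}$ ($\beta<\alpha'$) of the chain $\omega$. A monotonic sierpinskisation of $\omega\alpha'$ and $\omega$ is a poset obtained from a bijection $\varphi:\omega\to\omega\alpha'$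 such that $\varphi^{-1}$ is order-preserving on each $\omega\times\{\beta\}$, by ordering $\mathbb N$ as follows: $x$ is below $y$ if and only if $x\le y$ in $\mathbb N$ and $\varphi(x)\le\varphi(y)$ in $\omega\alpha'$. Let $\alpha$ be a countable ordinal. If $\alpha<\omega$, let $S_\alpha$ be the chain $\alpha$. If $\alpha=\omega\alpha'+n$ with $\alpha'\neq 0$ and $n<\omega$, let $S_\alpha:=\Omega(\alpha')\oplus n$, the direct sum (disjoint union, elements of different summands being incomparable) of a monotonic sierpinskisation $\Omega(\alpha')$ of $\omega\alpha'$ and $\omega$ and of the $n$-element chain $n$. Theorem. Let $\alpha$ be a countable ordinal. Then a poset $S_\alpha$ as above exists, and for every such $S_\alpha$ (whatever the choice of $\Omega(\alpha')$) the join-semilattice $Q_\alpha:=I_{<\omega}(S_\alpha)$ has the following properties: (i) $Q_\alpha$ is isomorphic to a join-subsemilattice of $[\omega]^{<\omega}$; (ii) $Q_\alpha\in\mathbb J_\alpha$; (iii) $Q_\alpha$ embeds as a join-semilattice in every join-subsemilattice of $[\omega]^{<\omega}$ which belongs to $\mathbb J_\alpha$. -/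

import Mathlib

universe u v

/-! ### Join-subsemilattices -/

/-- A join-subsemilattice of `L`: a subset closed under binary joins. -/
structure JoinSubsemilattice (L : Type u) [SemilatticeSup L] where
  carrier : Set L
  supClosed : SupClosed carrier

namespace JoinSubsemilattice

variable {L : Type u} [SemilatticeSup L]

instance : CoeSort (JoinSubsemilattice L) (Type u) := ⟨fun P => {x : L // x ∈ P.carrier}⟩

/-- The order and the joins of a join-subsemilattice are those of the ambient semilattice. -/
instance (P : JoinSubsemilattice L) : SemilatticeSup P :=
  Subtype.semilatticeSup (P := fun x => x ∈ P.carrier) fun _ _ hx hy => P.supClosed hx hy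

end JoinSubsemilattice

/-- `JoinEmbeds Q P`: the join-semilattice `Q` is embeddable in `P` as a join-semilattice, i.e. there
is a one-to-one map `f : Q → P` with `f (x ⊔ y) = f x ⊔ f y`. -/
def JoinEmbeds (Q : Type u) (P : Type v) [SemilatticeSup Q] [SemilatticeSup P] : Prop :=
  ∃ f : SupHom Q P, Function.Injective f

/-! ### Finitely generated initial segments and the classes `𝕁_α` -/

/-- `I_{<ω}(S)`: the finitely generated initial segments of `S`, ordered by inclusion. The empty
initial segment is generated by the empty set. -/
def FGInitSeg (S : Type u) [PartialOrder S] : Type u :=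
  {I : LowerSet S // ∃ F : Set S, F.Finite ∧ lowerClosure F = I}

/-- The join of two finitely generated initial segments is their union. -/
instance (S : Type u) [PartialOrder S] : SemilatticeSup (FGInitSeg S) :=
  Subtype.semilatticeSup (P := fun I : LowerSet S => ∃ F : Set S, F.Finite ∧ lowerClosure F = I) (by
    rintro _ _ ⟨F, hF, rfl⟩ ⟨G, hG, rfl⟩
    exact ⟨F ∪ G, hF.union hG, lowerClosure_union F G⟩)

/-- `P ∈ 𝕁_α`: the join-semilattice `P` has a least element and the poset `J(P)` of its ideals,
ordered by inclusion, contains a chain of order type `I(α)`, the order type of the chain of initial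
segments of a chain of type `α`. -/
def MemJ (α : Ordinal.{u}) (P : Type v) [SemilatticeSup P] : Prop :=
  (∃ b : P, IsBot b) ∧ Nonempty (LowerSet α.ToType ↪o Order.Ideal P)

/-! ### Monotonic sierpinskisations and the posets `S_α` -/

/-- Data of a monotonic sierpinskisation of `ω α'` and `ω`, where `A` is a chain of type `α'`: a
bijection `φ` from `ℕ` onto the ordinal sum `A ×ₗ ℕ` of `A` copies of `ℕ` (the `A`-coordinate is the
dominant one) such that `φ⁻¹` is order-preserving on each of the copies `{a} × ℕ`. -/
structure MonotonicBijection (A : Type u) [LinearOrder A] where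
  φ : ℕ ≃ A ×ₗ ℕ
  monotone_symm : ∀ a : A, Monotone fun k : ℕ => φ.symm (toLex (a, k))

/-- The monotonic sierpinskisation given by a bijection `φ`: its underlying set is `ℕ`. -/
def MonotonicSierpinskisation {A : Type u} [LinearOrder A] (_Φ : MonotonicBijection A) : Type := ℕ

/-- The order is the intersection of the natural order and of the order of `ω α'` pulled back along
`φ`. -/
instance {A : Type u} [LinearOrder A] (Φ : MonotonicBijection A) :
    PartialOrder (MonotonicSierpinskisation Φ) where
  le x y := @LE.le ℕ _ x y ∧ Φ.φ x ≤ Φ.φ y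
  le_refl x := ⟨Nat.le_refl x, le_refl (Φ.φ x)⟩
  le_trans _ _ _ h h' := ⟨Nat.le_trans h.1 h'.1, le_trans h.2 h'.2⟩
  le_antisymm _ _ h h' := Nat.le_antisymm h.1 h'.1

/-- `IsSPoset α S`: the poset `S` is (isomorphic to) a poset `S_α`. If `α < ω`, this is the chain `α`.
If `α = ω α' + n` with `α' ≠ 0` and `n < ω`, it is the direct sum `Ω(α') ⊕ n` (elements of different
summands are incomparable), where `Ω(α')` is any monotonic sierpinskisation of `ω α'` and `ω`, and `n`
is the chain with `n` elements. -/
inductive IsSPoset (α : Ordinal.{u}) (S : Type v) [PartialOrder S] : Prop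
  | finite (hα : α < Ordinal.omega0) (e : Nonempty (S ≃o α.ToType)) : IsSPoset α S
  | infinite (α' : Ordinal.{u}) (n : ℕ) (hα' : α' ≠ 0) (hα : α = Ordinal.omega0 * α' + n)
      (Φ : MonotonicBijection α'.ToType)
      (e : Nonempty (S ≃o MonotonicSierpinskisation Φ ⊕ Fin n)) : IsSPoset α S

/-! For (i), principal initial segments of `S_α` are finite and `S_α` is countable, so finitely
generated initial segments are finite subsets of a countable set, with union as join. For (ii), a
monotone surjection of `S_α` onto `α` pulls initial segments of `α` back to ideals. For (iii),
`joinEmbeds_fgInitSeg` asks for elements `g x` of `P` such that no `g x` lies below a finite join of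
values `g y` with `x ≰ y`. Let `C β`, `β ≤ α`, be a strictly increasing chain of ideals. In `Ω(α')`,
`x ≰ y` means that `y < x` in `ℕ` or that `y` is in an earlier copy of `ω`. If `x` is in copy `β`,
values from earlier copies lie in `C (ω β)`, while the values at numbers below `x`, together with
those on the chain `n`, have a single join `q`. So `g x ∈ C (ω (β + 1))` must avoid being below `r ⊔
q` for every `r ∈ C (ω β)`. Such an element exists (`exists_mem_ideal_not_le_sup`): the `ω` ideals
in between contribute infinitely many new points, and the finite set `q` misses one. -/

open Ordinal

/-! ### Finitely generated initial segments -/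

namespace FGInitSeg

variable {S : Type v} [PartialOrder S]

theorem le_iff {I J : FGInitSeg S} : I ≤ J ↔ ∀ x ∈ I.1, x ∈ J.1 := Iff.rfl

theorem mem_sup {I J : FGInitSeg S} {x : S} : x ∈ (I ⊔ J).1 ↔ x ∈ I.1 ∨ x ∈ J.1 := Iff.rfl

/-- The principal initial segment generated by `x`. -/
def principal (x : S) : FGInitSeg S := ⟨lowerClosure {x}, {x}, Set.finite_singleton x, rfl⟩

theorem mem_principal {x y : S} : y ∈ (principal x).1 ↔ y ≤ x := by
  simp [principal]

/-- The empty initial segment. -/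
def empty : FGInitSeg S := ⟨lowerClosure ∅, ∅, Set.finite_empty, rfl⟩

theorem notMem_empty (x : S) : x ∉ (empty : FGInitSeg S).1 := by
  simp [empty]

theorem finite_coe (hS : ∀ x : S, (Set.Iic x).Finite) (I : FGInitSeg S) :
    (I.1 : Set S).Finite := by
  obtain ⟨_, F, hF, rfl⟩ := I
  refine (hF.biUnion fun x _ => hS x).subset fun y hy => ?_
  obtain ⟨x, hx, hyx⟩ := mem_lowerClosure.1 hy
  exact Set.mem_biUnion hx hyx

end FGInitSeg

theorem exists_joinSubsemilattice_fgInitSeg {S : Type v} [PartialOrder S] [Countable S]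
    (hS : ∀ x : S, (Set.Iic x).Finite) :
    ∃ P : JoinSubsemilattice (Finset ℕ), Nonempty (FGInitSeg S ≃o P) := by
  classical
  obtain ⟨ι, hι⟩ := exists_injective_nat S
  let f : FGInitSeg S → Finset ℕ := fun I => (FGInitSeg.finite_coe hS I).toFinset.image ι
  have hf : ∀ I J, f I ≤ f J ↔ I ≤ J := by
    intro I J
    rw [FGInitSeg.le_iff]
    rw [Finset.image_subset_image_iff hι]
    simp only [Finset.subset_iff, Set.Finite.mem_toFinset, SetLike.mem_coe]
  have hsup : ∀ I J, f (I ⊔ J) = f I ⊔ f J := by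
    intro I J
    ext m
    simp only [f, Finset.sup_eq_union, Finset.mem_union, Finset.mem_image,
      Set.Finite.mem_toFinset, SetLike.mem_coe, FGInitSeg.mem_sup]
    grind
  refine ⟨⟨Set.range f, ?_⟩, ⟨(OrderEmbedding.ofMapLEIff f hf).orderIso⟩⟩
  rintro _ ⟨I, rfl⟩ _ ⟨J, rfl⟩
  exact ⟨I ⊔ J, hsup I J⟩

/-- An initial segment `J` yields the ideal of all `I` contained in the preimage of `J`; principal
segments recover `J` because `ρ` is onto. -/
theorem memJ_fgInitSeg {S : Type v} [PartialOrder S] {α : Ordinal.{u}} (ρ : S → α.ToType)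
    (hρ : Monotone ρ) (hsurj : Function.Surjective ρ) : MemJ α (FGInitSeg S) := by
  refine ⟨⟨FGInitSeg.empty, fun I x hx => absurd hx (FGInitSeg.notMem_empty x)⟩, ⟨?_⟩⟩
  refine OrderEmbedding.ofMapLEIff (fun J =>
    { carrier := {I | ∀ x ∈ I.1, ρ x ∈ J}
      lower' := fun I I' h hI x hx => hI x (h hx)
      nonempty' := ⟨FGInitSeg.empty, fun x hx => absurd hx (FGInitSeg.notMem_empty x)⟩
      directed' := fun I hI I' hI' => ⟨I ⊔ I', ?_, le_sup_left, le_sup_right⟩ }) ?_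
  · rintro x (hx | hx)
    exacts [hI x hx, hI' x hx]
  · intro J J'
    refine ⟨fun h a ha => ?_, fun h I hI x hx => h (hI x hx)⟩
    obtain ⟨x, rfl⟩ := hsurj a
    have : FGInitSeg.principal x ∈ {I : FGInitSeg S | ∀ x ∈ I.1, ρ x ∈ J} := fun y hy =>
      J.lower (hρ (FGInitSeg.mem_principal.1 hy)) ha
    exact h this x (FGInitSeg.mem_principal.2 le_rfl)

theorem memJ_fgInitSeg_of_rank {S : Type v} [PartialOrder S] {α : Ordinal.{u}} (ρ : S → Ordinal.{u})
    (hρ : Monotone ρ) (hrange : Set.range ρ = Set.Iio α) : MemJ α (FGInitSeg S) := by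
  have hlt : ∀ x, ρ x < α := fun x => hrange.subset ⟨x, rfl⟩
  refine memJ_fgInitSeg (fun x => ToType.mk ⟨ρ x, hlt x⟩)
    (fun x y h => ToType.mk.monotone (hρ h)) fun a => ?_
  obtain ⟨x, hx⟩ := hrange.superset (ToType.toOrd a).2
  exact ⟨x, by simp [hx]⟩

/-- A family `g` such that no `g x` is below a finite join of values `g y` with `x ≰ y` induces an
embedding of the join-semilattice of finitely generated initial segments. -/
theorem joinEmbeds_fgInitSeg {S : Type v} [PartialOrder S] (hS : ∀ x : S, (Set.Iic x).Finite)
    {P : Type*} [SemilatticeSup P] [OrderBot P] (g : S → P)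
    (hg : ∀ x, ∀ F : Finset S, (∀ y ∈ F, ¬ x ≤ y) → ¬ g x ≤ F.sup g) :
    JoinEmbeds (FGInitSeg S) P := by
  classical
  let f : FGInitSeg S → P := fun I => (FGInitSeg.finite_coe hS I).toFinset.sup g
  have key : ∀ I J, f I = f J → I ≤ J := by
    intro I J h x hx
    by_contra hxJ
    -- For `x` in `I` but not in `J`, no element of `J` is above `x`, yet `g x ≤ f I = f J`.
    refine hg x (FGInitSeg.finite_coe hS J).toFinset ?_ ?_
    · intro y hy hxy
      exact hxJ (J.1.lower hxy (by simpa using hy))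
    · change _ ≤ f J
      rw [← h]
      exact Finset.le_sup (f := g) (by simpa using hx)
  refine ⟨⟨f, fun I J => ?_⟩, fun I J h => le_antisymm (key I J h) (key J I h.symm)⟩
  simp only [f, ← Finset.sup_union]
  congr 1
  ext x
  simp [FGInitSeg.mem_sup]

/-! ### Ideals of join-subsemilattices of `Finset ℕ` -/

section Ideals

variable {P : JoinSubsemilattice (Finset ℕ)}

theorem JoinSubsemilattice.coe_sup (p q : P) : ((p ⊔ q : P) : Finset ℕ) = p.1 ∪ q.1 := rfl

/-- An element covered by the union of an ideal belongs to the ideal. -/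
theorem mem_ideal_of_subset_iUnion (I : Order.Ideal P) (p : P)
    (h : ∀ z ∈ p.1, ∃ r ∈ I, z ∈ r.1) : p ∈ I := by
  classical
  have key : ∀ s : Finset ℕ, s ⊆ p.1 → ∃ r ∈ I, s ⊆ r.1 := by
    intro s
    induction s using Finset.induction_on with
    | empty =>
      intro _
      obtain ⟨r, hr⟩ := I.nonempty
      exact ⟨r, hr, Finset.empty_subset _⟩
    | insert z s _ ih =>
      intro hs
      obtain ⟨r, hr, hsr⟩ := ih ((Finset.subset_insert z s).trans hs)
      obtain ⟨t, ht, hzt⟩ := h z (hs (Finset.mem_insert_self z s))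
      refine ⟨r ⊔ t, I.sup_mem hr ht, ?_⟩
      rw [JoinSubsemilattice.coe_sup]
      exact Finset.insert_subset (Finset.mem_union_right _ hzt)
        (hsr.trans Finset.subset_union_left)
  obtain ⟨r, hr, hpr⟩ := key p.1 subset_rfl
  exact I.lower (show p ≤ r from hpr) hr

/-- Above an infinite strictly increasing sequence of ideals starting at `V` there are elements
which are not below any join of an element of `V` and a given element. -/
theorem exists_mem_ideal_not_le_sup (D : ℕ → Order.Ideal P) (hD : StrictMono D)
    (W : Order.Ideal P) (hW : ∀ i, D i ≤ W) (q : P) :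
    ∃ p ∈ W, ∀ r ∈ D 0, ¬ p ≤ r ⊔ q := by
  -- Each ideal is determined by its union, so `D (i + 1)` covers a point that `D i` does not.
  have step : ∀ i, ∃ p ∈ D (i + 1), ∃ z ∈ p.1, ∀ r ∈ D i, z ∉ r.1 := by
    intro i
    obtain ⟨p, hp, hpi⟩ := Set.not_subset.1 (hD (Nat.lt_succ_self i)).not_ge
    by_contra! hcon
    exact hpi (mem_ideal_of_subset_iUnion _ p (hcon p hp))
  choose d hd z hz hzD using step
  have hinj : Function.Injective z := by
    have aux : ∀ i j, i < j → z i ≠ z j := fun i j hij h =>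
      hzD j (d i) (hD.monotone (Nat.succ_le_of_lt hij) (hd i)) (h ▸ hz i)
    intro i j h
    by_contra hne
    rcases lt_or_gt_of_ne hne with hlt | hlt
    exacts [aux i j hlt h, aux j i hlt h.symm]
  obtain ⟨i, hi⟩ : ∃ i, z i ∉ q.1 := by
    by_contra! hcon
    exact Set.infinite_range_of_injective hinj
      (q.1.finite_toSet.subset (Set.range_subset_iff.2 hcon))
  refine ⟨d i, hW _ (hd i), fun r hr hle => ?_⟩
  have := hle (hz i)
  rw [JoinSubsemilattice.coe_sup, Finset.mem_union] at this
  exact this.elim (hzD i r (hD.monotone (Nat.zero_le i) hr)) hi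

end Ideals

/-- A chain of ideals of type `I(α)`, indexed by the ordinals up to `α`. -/
theorem exists_ideal_chain {α : Ordinal.{u}} {P : Type v} [SemilatticeSup P]
    (e : LowerSet α.ToType ↪o Order.Ideal P) :
    ∃ C : Ordinal.{u} → Order.Ideal P, Monotone C ∧ StrictMonoOn C (Set.Iic α) := by
  let T : Ordinal.{u} → LowerSet α.ToType := fun β =>
    ⟨{a | (ToType.toOrd a : Ordinal) < β}, fun a b hba (ha : (ToType.toOrd a : Ordinal) < β) =>
      lt_of_le_of_lt (show (ToType.toOrd b : Ordinal) ≤ ToType.toOrd a from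
        ToType.mk.symm.monotone hba) ha⟩
  have hT : Monotone T := fun β γ h a (ha : (ToType.toOrd a : Ordinal) < β) =>
    show (ToType.toOrd a : Ordinal) < γ from lt_of_lt_of_le ha h
  refine ⟨fun β => e (T β), e.monotone.comp hT, fun β _ γ hγ h => e.strictMono ?_⟩
  refine lt_of_le_of_ne (hT h.le) fun heq => ?_
  have hβ : β < α := h.trans_le hγ
  -- The element at position `β` separates `T β` from `T γ`.
  have h1 : ToType.mk ⟨β, hβ⟩ ∈ T γ := by
    change ((ToType.mk.symm (ToType.mk ⟨β, hβ⟩) : Set.Iio α) : Ordinal) < γ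
    simpa using h
  rw [← heq] at h1
  change ((ToType.mk.symm (ToType.mk ⟨β, hβ⟩) : Set.Iio α) : Ordinal) < β at h1
  simp at h1

theorem exists_mem_notMem_ideal {P : Type v} [SemilatticeSup P] {I J : Order.Ideal P} (h : I < J) :
    ∃ p ∈ J, p ∉ I :=
  Set.not_subset.1 h.not_ge

theorem finset_sup_mem_ideal {ι : Type*} {P : Type v} [SemilatticeSup P] [OrderBot P]
    (I : Order.Ideal P) (F : Finset ι) (g : ι → P) (h : ∀ y ∈ F, g y ∈ I) : F.sup g ∈ I := by
  classical
  induction F using Finset.induction_on with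
  | empty => simp
  | insert a s _ ih =>
    rw [Finset.sup_insert]
    exact I.sup_mem (h a (Finset.mem_insert_self a s))
      (ih fun y hy => h y (Finset.mem_insert_of_mem hy))

/-! ### The posets `S_α` -/

section SPoset

variable {A : Type u} [LinearOrder A]

theorem MonotonicSierpinskisation.finite_Iic {Φ : MonotonicBijection A}
    (x : MonotonicSierpinskisation Φ) : (Set.Iic x).Finite :=
  (Set.finite_Iic (α := ℕ) x).subset fun _ hy => hy.1

theorem finite_Iic_sum {X Y : Type*} [Preorder X] [Preorder Y] (hX : ∀ x : X, (Set.Iic x).Finite)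
    (hY : ∀ y : Y, (Set.Iic y).Finite) (s : X ⊕ Y) : (Set.Iic s).Finite := by
  rcases s with x | y
  · refine ((hX x).image Sum.inl).subset ?_
    rintro (x' | y') h
    · exact ⟨x', Sum.inl_le_inl_iff.1 h, rfl⟩
    · exact absurd h Sum.not_inr_le_inl
  · refine ((hY y).image Sum.inr).subset ?_
    rintro (x' | y') h
    · exact absurd h Sum.not_inl_le_inr
    · exact ⟨y', Sum.inr_le_inr_iff.1 h, rfl⟩

theorem OrderIso.finite_Iic {X Y : Type*} [Preorder X] [Preorder Y] (e : X ≃o Y)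
    (hY : ∀ y : Y, (Set.Iic y).Finite) (x : X) : (Set.Iic x).Finite := by
  have : Set.Iic x = e ⁻¹' Set.Iic (e x) := by ext; simp
  rw [this]
  exact (hY _).preimage e.injective.injOn

theorem finite_toType {α : Ordinal.{u}} (hα : α < ω) : Finite α.ToType := by
  obtain ⟨n, rfl⟩ := lt_omega0.1 hα
  rw [← Cardinal.lt_aleph0_iff_finite, Cardinal.mk_toType, card_nat]
  exact Cardinal.natCast_lt_aleph0

theorem IsSPoset.finite_Iic {α : Ordinal.{u}} {S : Type v} [PartialOrder S] (h : IsSPoset α S)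
    (x : S) : (Set.Iic x).Finite := by
  cases h with
  | finite hα e =>
    have := finite_toType hα
    exact e.some.finite_Iic (fun y => Set.toFinite _) x
  | infinite α' n _ _ Φ e =>
    exact e.some.finite_Iic (finite_Iic_sum MonotonicSierpinskisation.finite_Iic
      fun y => Set.toFinite _) x

theorem IsSPoset.countable {α : Ordinal.{u}} {S : Type v} [PartialOrder S] (h : IsSPoset α S) :
    Countable S := by
  cases h with
  | finite hα e =>
    have := finite_toType hα
    exact e.some.injective.countable
  | infinite α' n _ _ Φ e =>
    have : Countable (MonotonicSierpinskisation Φ) := inferInstanceAs (Countable ℕ)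
    exact e.some.injective.countable

/-! ### The rank from `S_α` onto `α`, and membership in `𝕁_α`. -/

/-- The position of an element of `Ω(α') ⊕ n` in the chain `ω α' + n`. -/
noncomputable def sumRank {α' : Ordinal.{u}} (Φ : MonotonicBijection α'.ToType) (n : ℕ) :
    MonotonicSierpinskisation Φ ⊕ Fin n → Ordinal.{u} :=
  Sum.elim
    (fun x => ω * (ToType.toOrd (ofLex (Φ.φ x)).1 : Ordinal) + ((ofLex (Φ.φ x)).2 : ℕ))
    (fun i => ω * α' + (i : ℕ))

theorem omega0_mul_add_natCast_lt {β γ : Ordinal.{u}} (h : β < γ) (k : ℕ) : ω * β + k < ω * γ :=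
  calc ω * β + k < ω * β + ω := by gcongr; exact natCast_lt_omega0 k
    _ = ω * Order.succ β := (mul_succ _ _).symm
    _ ≤ ω * γ := by gcongr; exact Order.succ_le_of_lt h

theorem monotone_sumRank {α' : Ordinal.{u}} (Φ : MonotonicBijection α'.ToType) (n : ℕ) :
    Monotone (sumRank Φ n) := by
  rintro (x | i) (y | j) h
  · have h' := (Sum.inl_le_inl_iff.1 h).2
    simp only [sumRank, Sum.elim_inl]
    rcases Prod.Lex.le_iff.1 h' with hlt | ⟨heq, hle⟩
    · refine (omega0_mul_add_natCast_lt (ToType.mk.symm.strictMono hlt) _).le.trans ?_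
      exact le_self_add
    · rw [heq]
      gcongr
  · exact absurd h Sum.not_inl_le_inr
  · exact absurd h Sum.not_inr_le_inl
  · have h' := Sum.inr_le_inr_iff.1 h
    simp only [sumRank, Sum.elim_inr]
    gcongr
    exact h'

theorem range_sumRank {α' : Ordinal.{u}} (Φ : MonotonicBijection α'.ToType) (n : ℕ) :
    Set.range (sumRank Φ n) = Set.Iio (ω * α' + n) := by
  ext β
  constructor
  · rintro ⟨x | i, rfl⟩
    · exact (omega0_mul_add_natCast_lt (ToType.toOrd (ofLex (Φ.φ x)).1).2 _).trans_le le_self_add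
    · change ω * α' + ((i : ℕ) : Ordinal) < ω * α' + n
      gcongr
      exact i.2
  · intro hβ
    rcases lt_or_ge β (ω * α') with h | h
    · obtain ⟨k, hk⟩ := lt_omega0.1 (mod_lt β omega0_ne_zero)
      refine ⟨Sum.inl (Φ.φ.symm (toLex
        (ToType.mk ⟨β / ω, (lt_mul_iff_div_lt omega0_ne_zero).1 h⟩, k))), ?_⟩
      have : ω * (β / ω) + (k : Ordinal) = β := by rw [← hk, div_add_mod]
      change ω * (ToType.toOrd (ofLex (Φ.φ (Φ.φ.symm _))).1 : Ordinal) +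
        ((ofLex (Φ.φ (Φ.φ.symm _))).2 : ℕ) = β
      rw [Φ.φ.apply_symm_apply]
      simpa using this
    · obtain ⟨γ, rfl⟩ := exists_add_of_le h
      have hγ : γ < n := lt_of_add_lt_add_left (show ω * α' + γ < ω * α' + n from hβ)
      obtain ⟨i, rfl⟩ := lt_omega0.1 (hγ.trans (natCast_lt_omega0 n))
      exact ⟨Sum.inr ⟨i, by exact_mod_cast hγ⟩, rfl⟩

theorem IsSPoset.memJ {α : Ordinal.{u}} {S : Type v} [PartialOrder S] (h : IsSPoset α S) :
    MemJ α (FGInitSeg S) := by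
  cases h with
  | finite hα e => exact memJ_fgInitSeg e.some e.some.monotone e.some.surjective
  | infinite α' n _ hα Φ e =>
    refine memJ_fgInitSeg_of_rank (sumRank Φ n ∘ e.some)
      ((monotone_sumRank Φ n).comp e.some.monotone) ?_
    rw [e.some.surjective.range_comp, range_sumRank, hα]

/-! ### Embedding in the members of `𝕁_α`. -/

/-- In a monotonic sierpinskisation, `x ≰ y` forces `y` to lie strictly before `x`, or in an earlier
copy of `ω`. -/
theorem MonotonicSierpinskisation.lt_or_fst_lt_of_not_le {Φ : MonotonicBijection A}
    {x y : MonotonicSierpinskisation Φ} (h : ¬ x ≤ y) :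
    @LT.lt ℕ _ y x ∨ (ofLex (Φ.φ y)).1 < (ofLex (Φ.φ x)).1 := by
  by_contra hcon
  obtain ⟨hlt, h2⟩ := not_or.1 hcon
  have h1 := Nat.not_lt.1 hlt
  refine h ⟨h1, ?_⟩
  rw [not_lt] at h2
  rcases h2.lt_or_eq with hlt | heq
  · exact Prod.Lex.le_iff.2 (Or.inl hlt)
  · refine Prod.Lex.le_iff.2 (Or.inr ⟨heq, ?_⟩)
    by_contra! hlt
    -- Within one copy, monotonicity of `φ⁻¹` gives `y ≤ x` in `ℕ`, hence `x = y`.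
    have := Φ.monotone_symm (ofLex (Φ.φ x)).1 hlt.le
    have hx : Φ.φ.symm (toLex ((ofLex (Φ.φ x)).1, (ofLex (Φ.φ x)).2)) = x := Φ.φ.symm_apply_apply x
    have hy : Φ.φ.symm (toLex ((ofLex (Φ.φ x)).1, (ofLex (Φ.φ y)).2)) = y := by
      rw [heq]; exact Φ.φ.symm_apply_apply y
    simp only [hx, hy] at this
    have hxy : x = y := le_antisymm (α := ℕ) h1 this
    rw [hxy] at hlt
    exact lt_irrefl _ hlt

/-- Given, for every `x : ℕ`, elements which escape any prescribed element, choose them recursively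
so that each escapes all the previous ones. -/
theorem exists_seq_escaping {P : Type v} [SemilatticeSup P] (V : ℕ → Order.Ideal P)
    (W : ℕ → Order.Ideal P) (h : ∀ x q, ∃ p ∈ W x, ∀ r ∈ V x, ¬ p ≤ r ⊔ q) (G : P) :
    ∃ (g : ℕ → P) (s : ℕ → P), (∀ x, g x ∈ W x) ∧ (∀ x, G ≤ s x) ∧
      (∀ x y, y < x → g y ≤ s x) ∧ ∀ x, ∀ r ∈ V x, ¬ g x ≤ r ⊔ s x := by
  choose pick hW hV using h
  -- `s x` is the join of `G` and of all elements chosen before stage `x`.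
  let s : ℕ → P := fun x => Nat.rec G (fun x t => t ⊔ pick x t) x
  have hs : Monotone s := monotone_nat_of_le_succ fun x => le_sup_left
  refine ⟨fun x => pick x (s x), s, fun x => hW _ _, fun x => hs (Nat.zero_le x), ?_,
    fun x => hV _ _⟩
  exact fun x y hyx => le_trans le_sup_right (hs (Nat.succ_le_of_lt hyx))

theorem IsSPoset.joinEmbeds {α : Ordinal.{u}} {S : Type v} [PartialOrder S] (h : IsSPoset α S)
    (P : JoinSubsemilattice (Finset ℕ)) (hP : MemJ α P) : JoinEmbeds (FGInitSeg S) P := by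
  obtain ⟨⟨b, hb⟩, ⟨e⟩⟩ := hP
  let _ : OrderBot P := { bot := b, bot_le := hb }
  obtain ⟨C, hC, hCs⟩ := exists_ideal_chain e
  have hfin := h.finite_Iic
  cases h with
  | finite hα eS =>
    obtain ⟨eS⟩ := eS
    have hlt : ∀ x, (ToType.toOrd (eS x) : Ordinal) < α := fun x => (ToType.toOrd (eS x)).2
    have hex : ∀ x : S, ∃ p ∈ C (Order.succ (ToType.toOrd (eS x) : Ordinal)),
        p ∉ C (ToType.toOrd (eS x) : Ordinal) := fun x =>
      exists_mem_notMem_ideal (hCs (hlt x).le (Order.succ_le_of_lt (hlt x)) (Order.lt_succ _))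
    choose g hg hg' using hex
    refine joinEmbeds_fgInitSeg hfin g fun x F hF hle => hg' x ?_
    refine (C _).lower hle (finset_sup_mem_ideal _ F g fun y hy => ?_)
    -- In a chain `x ≰ y` means `y < x`, so these values already lie in the ideal that `g x` avoids.
    have hyx : eS y < eS x := not_le.1 fun hxy => hF y hy (eS.le_iff_le.1 hxy)
    exact hC (Order.succ_le_of_lt (ToType.mk.symm.strictMono hyx)) (hg y)
  | infinite α' n hα' hα Φ eS =>
    obtain ⟨eS⟩ := eS
    have hle : ω * α' ≤ α := hα ▸ le_self_add
    have hex : ∀ i : Fin n, ∃ p ∈ C (ω * α' + ((i + 1 : ℕ) : Ordinal)),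
        p ∉ C (ω * α' + ((i : ℕ) : Ordinal)) := by
      intro i
      refine exists_mem_notMem_ideal (hCs ?_ ?_ ?_)
      · simp only [Set.mem_Iic, hα]
        gcongr
        exact i.2.le
      · simp only [Set.mem_Iic, hα]
        gcongr
        exact i.2
      · gcongr
        exact Nat.lt_succ_self _
    choose t ht ht' using hex
    let bl : ℕ → Ordinal.{u} := fun x => (ToType.toOrd (ofLex (Φ.φ x)).1 : Ordinal)
    have hbl : ∀ x, bl x < α' := fun x => (ToType.toOrd (ofLex (Φ.φ x)).1).2
    have hpick : ∀ x (q : P), ∃ p ∈ C (ω * Order.succ (bl x)),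
        ∀ r ∈ C (ω * bl x), ¬ p ≤ r ⊔ q := by
      intro x q
      have hlt : ∀ k : ℕ, ω * bl x + k < ω * Order.succ (bl x) :=
        omega0_mul_add_natCast_lt (Order.lt_succ _)
      have hleα : ω * Order.succ (bl x) ≤ α := by
        refine le_trans ?_ hle
        gcongr
        exact Order.succ_le_of_lt (hbl x)
      have := exists_mem_ideal_not_le_sup (fun k : ℕ => C (ω * bl x + k))
        (fun k l hkl => hCs ((hlt k).le.trans hleα) ((hlt l).le.trans hleα) (by gcongr))
        (C (ω * Order.succ (bl x))) (fun k => hC (hlt k).le) q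
      simpa using this
    -- Starting from the join of all `t i` makes every `g x` escape the values on the chain `n`,
    -- which is incomparable to `Ω(α')`.
    obtain ⟨g, s, hg, hGs, hgs, hesc⟩ := exists_seq_escaping (fun x => C (ω * bl x))
      (fun x => C (ω * Order.succ (bl x))) hpick (Finset.univ.sup t)
    let f : MonotonicSierpinskisation Φ ⊕ Fin n → P := Sum.elim g t
    refine joinEmbeds_fgInitSeg hfin (f ∘ eS) fun x F hF hle' => ?_
    have hF' : ∀ y ∈ F, ¬ eS x ≤ eS y := fun y hy hxy => hF y hy (eS.le_iff_le.1 hxy)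
    change f (eS x) ≤ _ at hle'
    rcases hx : eS x with m | i
    · rw [hx] at hle' hF'
      -- Values from earlier copies are absorbed in `r`; values at smaller numbers and on the chain
      -- are absorbed in `s m`.
      have hsplit : ∀ F : Finset S, (∀ y ∈ F, ¬ Sum.inl m ≤ eS y) →
          ∃ r ∈ C (ω * bl m), F.sup (f ∘ eS) ≤ r ⊔ s m := by
        classical
        intro F
        induction F using Finset.induction_on with
        | empty => exact fun _ => ⟨⊥, by simp, by simp⟩
        | insert y F _ ih =>
          intro hy
          obtain ⟨r, hr, hrle⟩ := ih fun z hz => hy z (Finset.mem_insert_of_mem hz)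
          have hym := hy y (Finset.mem_insert_self y F)
          rw [Finset.sup_insert]
          rcases hy' : eS y with l | j
          · rw [hy'] at hym
            have hval : (f ∘ eS) y = g l := congrArg f hy'
            rw [hval]
            rcases MonotonicSierpinskisation.lt_or_fst_lt_of_not_le
              (fun hle => hym (Sum.inl_le_inl_iff.2 hle)) with hlt | hlt
            · exact ⟨r, hr, sup_le ((hgs m l hlt).trans le_sup_right) hrle⟩
            · refine ⟨r ⊔ g l, (C _).sup_mem hr (hC ?_ (hg l)), sup_le ?_ ?_⟩
              · gcongr
                exact Order.succ_le_of_lt (ToType.mk.symm.strictMono hlt)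
              · exact le_sup_right.trans le_sup_left
              · exact hrle.trans (sup_le_sup_right le_sup_left _)
          · have hval : (f ∘ eS) y = t j := congrArg f hy'
            rw [hval]
            exact ⟨r, hr, sup_le (((Finset.le_sup (Finset.mem_univ j)).trans (hGs m)).trans
              le_sup_right) hrle⟩
      obtain ⟨r, hr, hrle⟩ := hsplit F hF'
      exact hesc m r hr (hle'.trans hrle)
    · rw [hx] at hle' hF'
      -- All `g l` lie in `C (ω α')`, and each `t j` with `j < i` in `C (ω α' + i)`, the ideal that
      -- `t i` avoids.
      refine ht' i ((C _).lower hle' (finset_sup_mem_ideal _ F _ fun y hy => ?_))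
      have hyi := hF' y hy
      rcases hy' : eS y with l | j
      · have hval : (f ∘ eS) y = g l := congrArg f hy'
        rw [hval]
        refine hC (le_trans ?_ le_self_add) (hg l)
        gcongr
        exact Order.succ_le_of_lt (hbl l)
      · have hval : (f ∘ eS) y = t j := congrArg f hy'
        rw [hval]
        rw [hy', Sum.inr_le_inr_iff, not_le] at hyi
        refine hC ?_ (ht j)
        gcongr
        exact hyi

/-! ### Existence -/

/-- Any bijection `ℕ ≃ A × ℕ` splits `ℕ` into infinite fibres over `A`; enumerating each fibre
increasingly gives the monotonicity. -/
theorem nonempty_monotonicBijection [Nonempty A] [Countable A] :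
    Nonempty (MonotonicBijection A) := by
  classical
  obtain ⟨e⟩ : Nonempty (ℕ ≃ A × ℕ) := nonempty_equiv_of_countable
  have hinf : ∀ a : A, Infinite {m : ℕ | (e m).1 = a} := fun a =>
    Infinite.of_injective (fun k : ℕ => ⟨e.symm (a, k), by simp⟩) fun k l h => by
      simpa using h
  let o : ∀ a : A, ℕ ≃o {m : ℕ | (e m).1 = a} := fun a => Nat.Subtype.orderIsoOfNat _
  let ψ : A ×ₗ ℕ ≃ ℕ := ofLex.trans <| (Equiv.sigmaEquivProd A ℕ).symm.trans <|
    (Equiv.sigmaCongrRight fun a => (o a).toEquiv).trans (Equiv.sigmaFiberEquiv fun m => (e m).1)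
  exact ⟨⟨ψ.symm, fun a k l hkl => (o a).monotone hkl⟩⟩

theorem exists_isSPoset (α : Ordinal.{u}) (hα : α.card ≤ Cardinal.aleph0) :
    ∃ (S : Type v) (_ : PartialOrder S), IsSPoset α S := by
  rcases lt_or_ge α ω with h | h
  · have := finite_toType h
    let _ := Fintype.ofFinite α.ToType
    exact ⟨ULift (Fin (Fintype.card α.ToType)), inferInstance,
      .finite h ⟨OrderIso.trans ⟨Equiv.ulift, Iff.rfl⟩ (Fintype.orderIsoFinOfCardEq α.ToType rfl)⟩⟩
  · obtain ⟨n, hn⟩ := lt_omega0.1 (mod_lt α omega0_ne_zero)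
    have hne : α / ω ≠ 0 := ((div_pos omega0_ne_zero).2 h).ne'
    have : Nonempty (α / ω).ToType := nonempty_toType_iff.2 hne
    have : Countable (α / ω).ToType := by
      rw [← Cardinal.mk_le_aleph0_iff, Cardinal.mk_toType]
      refine (card_le_card ?_).trans hα
      -- `α / ω ≤ ω * (α / ω) ≤ α`, so the quotient is countable.
      exact (le_mul_of_one_le_left' one_lt_omega0.le).trans (mul_div_le α ω)
    obtain ⟨Φ⟩ := nonempty_monotonicBijection (A := (α / ω).ToType)
    exact ⟨ULift (MonotonicSierpinskisation Φ ⊕ Fin n), inferInstance,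
      .infinite (α / ω) n hne (by rw [← hn, div_add_mod]) Φ ⟨Equiv.ulift, Iff.rfl⟩⟩

end SPoset

theorem mainTheorem11 (α : Ordinal.{u}) (hα : α.card ≤ Cardinal.aleph0) :
    (∃ (S : Type v) (_ : PartialOrder S), IsSPoset α S) ∧
    ∀ (S : Type v) [PartialOrder S], IsSPoset α S →
      (∃ P : JoinSubsemilattice (Finset ℕ), Nonempty (FGInitSeg S ≃o P)) ∧
      MemJ α (FGInitSeg S) ∧
      ∀ P : JoinSubsemilattice (Finset ℕ), MemJ α P → JoinEmbeds (FGInitSeg S) P :=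
  ⟨exists_isSPoset α hα, fun _ _ h =>
    ⟨have := h.countable; exists_joinSubsemilattice_fgInitSeg h.finite_Iic, h.memJ, h.joinEmbeds⟩⟩
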